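/- For a finite nonempty set $S$ of points in the Euclidean plane let $w(S)$ denote the length of a Euclidean minimum spanning tree of $S$, i.e. the minimum, over all spanning trees on the vertex set $S$, of the sum of the Euclidean lengths of the edges (so $w(S)=0$ if $|S|=1$). For a finite set $P$ of at least two points in the plane let $$\gamma(P)=\max_{P=R\cup B}\frac{w(R)+w(B)}{w(P)},$$ where the maximum is over all partitions of $P$ into two nonempty disjoint sets $R,B$, and let $$\Delta(P)=\frac{\max\{|ab| : a,b\in P,\ a\neq b\}}{\min\{|ab| : a,b\in P,\ a\neq b\}}$$ be the spread of $P$. Theorem. Let $\alpha\ge 2^{1/2}3^{1/4}\pi^{-1/2}$. There is an $N=N(\alpha)$ such that every set $P$ of $n\ge N$ points in the plane with $\Delta(P)\le\alpha n^{1/2}$ satisfies $$\gamma(P)\ \ge\ 1+\frac{1}{11(2\alpha+1)^2}.$$ In particular $\gamma(P)\ge 1+\Omega(\alpha^{-2})$: there is an absolute constant $c>0$ such that for every such $\alpha$, all sufficiently large $n$ (depending on $\alpha$), and every set $P$ of $n$ points in the plane with $\Delta(P)\le\alpha n^{1/2}$, we have $\gamma(P)\ge 1+c\,\alpha^{-2}$.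 -/

import Mathlib

/-- The Euclidean plane. -/
abbrev Plane : Type := EuclideanSpace ℝ (Fin 2)

/-- The Euclidean length of an edge, given as an unordered pair of points of `S`. -/
noncomputable def edgeLength {S : Finset Plane} (e : Sym2 S) : ℝ :=
  Sym2.lift ⟨fun p q : S => dist (p : Plane) (q : Plane), fun _ _ => dist_comm _ _⟩ e

open Classical in
/-- The total Euclidean length of a (geometric) graph on the finite point set `S`. -/
noncomputable def graphLength {S : Finset Plane} (T : SimpleGraph S) : ℝ :=
  ∑ e ∈ T.edgeFinset, edgeLength e

/-- The set of lengths of all spanning trees of the finite point set `S`. -/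
def treeLengths (S : Finset Plane) : Set ℝ :=
  {l : ℝ | ∃ T : SimpleGraph S, T.IsTree ∧ graphLength T = l}

/-- `w(S)`: the length of a Euclidean minimum spanning tree of the finite point set `S`. -/
noncomputable def mstLength (S : Finset Plane) : ℝ :=
  sInf (treeLengths S)

/-- For nonempty `S` the infimum defining `w(S)` is a minimum over spanning trees. -/
theorem mstLength_isLeast {S : Finset Plane} (hS : S.Nonempty) :
    IsLeast (treeLengths S) (mstLength S) := by
  have hfin : (treeLengths S).Finite :=
    (Set.finite_range (graphLength (S := S))).subset (by
      rintro l ⟨T, -, rfl⟩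
      exact ⟨T, rfl⟩)
  have hne : (treeLengths S).Nonempty := by
    have : Nonempty S := hS.to_subtype
    obtain ⟨T, -, hT⟩ := (SimpleGraph.connected_top (V := S)).exists_isTree_le
    exact ⟨_, T, hT, rfl⟩
  exact ⟨hne.csInf_mem hfin, fun l hl => csInf_le hfin.bddBelow hl⟩

/-- The set of ratios `(w(R) + w(B)) / w(P)` over all nontrivial bipartitions `P = R ∪ B`. -/
def mstRatios (P : Finset Plane) : Set ℝ :=
  {x : ℝ | ∃ R B : Finset Plane, R.Nonempty ∧ B.Nonempty ∧ Disjoint R B ∧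
    (R : Set Plane) ∪ (B : Set Plane) = (P : Set Plane) ∧
    (mstLength R + mstLength B) / mstLength P = x}

/-- `γ(P)`: the max MST-ratio of the finite point set `P`. -/
noncomputable def maxMSTRatio (P : Finset Plane) : ℝ :=
  sSup (mstRatios P)

/-- If `P` has at least two points, the supremum defining `γ(P)` is a maximum over the nontrivial
bipartitions of `P`. -/
theorem maxMSTRatio_isGreatest {P : Finset Plane} (hP : 2 ≤ P.card) :
    IsGreatest (mstRatios P) (maxMSTRatio P) := by
  classical
  have hfin : (mstRatios P).Finite := by
    refine (((P.powerset ×ˢ P.powerset).image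
      fun s => (mstLength s.1 + mstLength s.2) / mstLength P).finite_toSet).subset ?_
    rintro x ⟨R, B, -, -, -, h, rfl⟩
    have h' : R ∪ B = P := by exact_mod_cast h
    subst h'
    simp only [Finset.coe_image, Set.mem_image, Finset.mem_coe, Finset.mem_product,
      Finset.mem_powerset]
    exact ⟨(R, B), ⟨Finset.subset_union_left, Finset.subset_union_right⟩, rfl⟩
  have hne : (mstRatios P).Nonempty := by
    obtain ⟨p, hp, q, hq, hpq⟩ := Finset.one_lt_card.mp hP
    refine ⟨_, {p}, P.erase p, Finset.singleton_nonempty p,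
      ⟨q, Finset.mem_erase.mpr ⟨hpq.symm, hq⟩⟩, ?_, ?_, rfl⟩
    · simp
    · ext x
      by_cases hx : x = p <;> simp [hx, hp]
  exact ⟨hne.csSup_mem hfin, fun l hl => le_csSup hfin.bddAbove hl⟩

/-- `Δ(P)`: the spread (aspect ratio) of `P`, that is, the largest distance between two points of
`P` divided by the smallest distance between two distinct points of `P`. -/
noncomputable def spread (P : Finset Plane) : ℝ :=
  Metric.diam (P : Set Plane) / Set.infsep (P : Set Plane)

/-! Write n, m, D, w for the size, least distance, diameter and tree length of P, and put l = 2w/n,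
about twice the mean edge length. Rooting a minimum tree shows that nearest-neighbour distances sum
to at most w + D, so the gains l - nn(p) over points with nn(p) < l sum to at least nl - w - D = w -
D. A greedy choice (`exists_separated_subset_weight`) keeps a fraction 1/M of this gain on an
l-separated set R, where M = (2l/m + 1)² comes from disc packing. Colour R against the rest B.
Separation gives w(R) ≥ l(|R| - 1). Each r in R has its nearest neighbour in B, so w(P) ≤ w(B) + ∑
nn(r). Adding, w(R) + w(B) ≥ w + (w - D)/M - l (`exists_bipartition_mstLength`). It remains to bound
M: Few's strip bound gives w ≤ (3/2)D√n, and D ≤ αm√n then gives 2l/m ≤ 6α. Both D and l are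
negligible against w for large n. -/

/-! ### Comparison inequalities for tree lengths -/

@[simp] theorem edgeLength_mk {S : Finset Plane} (p q : S) :
    edgeLength s(p, q) = dist (p : Plane) q := rfl

theorem edgeLength_nonneg {S : Finset Plane} (e : Sym2 S) : 0 ≤ edgeLength e := by
  induction e with
  | h p q => exact dist_nonneg (x := (p : Plane))

theorem mstLength_nonneg {S : Finset Plane} (hS : S.Nonempty) : 0 ≤ mstLength S := by
  obtain ⟨T, -, hT⟩ := (mstLength_isLeast hS).1
  rw [← hT]
  exact Finset.sum_nonneg fun e _ => edgeLength_nonneg e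

/-- Every connected graph on `S` is at least as long as a minimum spanning tree. -/
theorem mstLength_le_graphLength {S : Finset Plane} (hS : S.Nonempty) {G : SimpleGraph S}
    (hG : G.Connected) : mstLength S ≤ graphLength G := by
  classical
  obtain ⟨T, hle, hT⟩ := hG.exists_isTree_le
  refine ((mstLength_isLeast hS).2 ⟨T, hT, rfl⟩).trans ?_
  unfold graphLength
  exact Finset.sum_le_sum_of_subset_of_nonneg (SimpleGraph.edgeFinset_mono hle)
    fun e _ _ => edgeLength_nonneg e

/-- Rooting a connected graph at `r` charges every other vertex to its own edge. -/
theorem sum_erase_le_graphLength {S : Finset Plane} {G : SimpleGraph S} (hG : G.Connected)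
    (r : S) (d : Plane → ℝ) (hd : ∀ p ∈ S, ∀ q ∈ S, p ≠ q → d p ≤ dist p q) :
    ∑ p ∈ S.erase r, d p ≤ graphLength G := by
  classical
  have key : ∀ v : S, v ≠ r → ∃ u : S, G.Adj v u ∧ G.dist u r < G.dist v r := by
    intro v hv
    obtain ⟨p, hp⟩ := hG.exists_walk_length_eq_dist v r
    cases p with
    | nil => exact absurd rfl hv
    | cons h p =>
      refine ⟨_, h, ?_⟩
      have := SimpleGraph.dist_le p
      rw [SimpleGraph.Walk.length_cons] at hp
      omega
  choose! f hadj hlt using key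
  have hsum : ∑ p ∈ S.erase r, d p = ∑ v ∈ Finset.univ.erase r, d (v : S) := by
    refine (Finset.sum_bij (fun (v : S) _ => (v : Plane)) ?_ ?_ ?_ ?_).symm
    · intro v hv
      exact Finset.mem_erase.2 ⟨fun h => (Finset.mem_erase.1 hv).1 (Subtype.ext h), v.2⟩
    · intro a _ b _ h
      exact Subtype.ext h
    · intro b hb
      rw [Finset.mem_erase] at hb
      exact ⟨⟨b, hb.2⟩, Finset.mem_erase.2
        ⟨fun h => hb.1 (congrArg Subtype.val h), Finset.mem_univ _⟩, rfl⟩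
    · intros; rfl
  rw [hsum]
  -- Two vertices charged to the same edge would each be strictly closer to `r` than the other.
  have hinj : Set.InjOn (fun v : S => s(v, f v)) (Finset.univ.erase r : Finset S) := by
    intro v hv w hw h
    have hv' : v ≠ r := by simpa using hv
    have hw' : w ≠ r := by simpa using hw
    rcases Sym2.eq_iff.1 h with h | h
    · exact h.1
    · have h1 := hlt v hv'
      have h2 := hlt w hw'
      rw [h.2] at h1
      rw [← h.1] at h2
      omega
  calc ∑ v ∈ Finset.univ.erase r, d (v : S)
      ≤ ∑ v ∈ Finset.univ.erase r, edgeLength s(v, f v) := by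
        refine Finset.sum_le_sum fun v hv => ?_
        have hv' : v ≠ r := by simpa using hv
        exact hd v v.2 (f v) (f v).2 fun h => (hadj v hv').ne (Subtype.ext h)
    _ = ∑ e ∈ (Finset.univ.erase r).image fun v => s(v, f v), edgeLength e :=
        (Finset.sum_image hinj).symm
    _ ≤ graphLength G := by
        unfold graphLength
        refine Finset.sum_le_sum_of_subset_of_nonneg ?_ fun e _ _ => edgeLength_nonneg e
        intro e he
        obtain ⟨v, hv, rfl⟩ := Finset.mem_image.1 he
        have hv' : v ≠ r := by simpa using hv
        simpa using hadj v hv'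

/-- Applied with `d` constant, and with `d` the nearest-neighbour distance. -/
theorem sum_erase_le_mstLength {S : Finset Plane} {r : Plane} (hr : r ∈ S) (d : Plane → ℝ)
    (hd : ∀ p ∈ S, ∀ q ∈ S, p ≠ q → d p ≤ dist p q) :
    ∑ p ∈ S.erase r, d p ≤ mstLength S := by
  obtain ⟨T, hT, hl⟩ := (mstLength_isLeast ⟨r, hr⟩).1
  rw [← hl]
  exact sum_erase_le_graphLength hT.connected ⟨r, hr⟩ d hd

theorem mul_card_sub_one_le_mstLength {S : Finset Plane} (hS : S.Nonempty) {l : ℝ}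
    (hl : ∀ p ∈ S, ∀ q ∈ S, p ≠ q → l ≤ dist p q) :
    l * ((S.card : ℝ) - 1) ≤ mstLength S := by
  obtain ⟨r, hr⟩ := hS
  have h := sum_erase_le_mstLength hr (fun _ => l) hl
  rw [Finset.sum_const, Finset.card_erase_of_mem hr, nsmul_eq_mul,
    Nat.cast_sub (Finset.card_pos.2 ⟨r, hr⟩)] at h
  push_cast at h
  linarith

open Classical in
/-- Attaching a new point to a point of `S` by an edge. -/
theorem mstLength_insert_le {S : Finset Plane} {p q : Plane} (hp : p ∉ S) (hq : q ∈ S) :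
    mstLength (insert p S) ≤ mstLength S + dist p q := by
  obtain ⟨T, hT, hl⟩ := (mstLength_isLeast ⟨q, hq⟩).1
  rw [← hl]
  let f : S ↪ (insert p S : Finset Plane) :=
    ⟨fun v => ⟨v, Finset.mem_insert_of_mem v.2⟩, fun a b h => Subtype.ext (by simpa using h)⟩
  let p' : (insert p S : Finset Plane) := ⟨p, Finset.mem_insert_self _ _⟩
  let q' : (insert p S : Finset Plane) := f ⟨q, hq⟩
  have hne : p' ≠ q' := fun h => hp (by
    have : p = q := congrArg Subtype.val h
    rwa [this])
  let G := T.map f ⊔ SimpleGraph.edge p' q'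
  have hreach : ∀ v, G.Reachable v q' := by
    rintro ⟨v, hv⟩
    rcases Finset.mem_insert.1 hv with rfl | hv'
    · refine SimpleGraph.Adj.reachable (Or.inr ?_)
      rw [SimpleGraph.edge_adj]
      exact ⟨Or.inl ⟨rfl, rfl⟩, hne⟩
    · have h := (hT.connected.preconnected ⟨v, hv'⟩ ⟨q, hq⟩).map (SimpleGraph.Embedding.map f T).toHom
      exact h.mono le_sup_left
  have hG : G.Connected :=
    { preconnected := fun u v => (hreach u).trans (hreach v).symm
      nonempty := ⟨p'⟩ }
  refine (mstLength_le_graphLength ⟨p, Finset.mem_insert_self _ _⟩ hG).trans ?_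
  have hadj : ∀ a b, G.Adj a b → (T.map f).Adj a b ∨ (SimpleGraph.edge p' q').Adj a b :=
    fun a b h => h
  clear_value G
  have hsub : G.edgeFinset ⊆ insert s(p', q') (T.edgeFinset.image (Sym2.map f)) := by
    intro e
    induction e with
    | h a b =>
      intro he
      rw [SimpleGraph.mem_edgeFinset, SimpleGraph.mem_edgeSet] at he
      rcases hadj _ _ he with he | he
      · rw [SimpleGraph.map_adj] at he
        obtain ⟨u, v, huv, rfl, rfl⟩ := he
        refine Finset.mem_insert_of_mem (Finset.mem_image.2 ⟨s(u, v), ?_, rfl⟩)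
        simpa using huv
      · rw [SimpleGraph.edge_adj] at he
        rcases he.1 with ⟨rfl, rfl⟩ | ⟨rfl, rfl⟩
        · exact Finset.mem_insert_self _ _
        · rw [Sym2.eq_swap]
          exact Finset.mem_insert_self _ _
  have hnot : s(p', q') ∉ T.edgeFinset.image (Sym2.map f) := by
    intro h
    obtain ⟨e, -, he⟩ := Finset.mem_image.1 h
    have hmem : p' ∈ Sym2.map f e := by rw [he]; exact Sym2.mem_mk_left _ _
    obtain ⟨a, -, ha⟩ := Sym2.mem_map.1 hmem
    exact hp (by have := congrArg Subtype.val ha; rw [← show (a : Plane) = p from this]; exact a.2)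
  unfold graphLength
  refine (Finset.sum_le_sum_of_subset_of_nonneg hsub fun e _ _ => edgeLength_nonneg e).trans ?_
  rw [Finset.sum_insert hnot, Finset.sum_image fun a _ b _ h => Sym2.map.injective f.injective h,
    add_comm]
  refine add_le_add (Finset.sum_le_sum fun e _ => le_of_eq ?_) le_rfl
  induction e with
  | h a b => rfl

theorem mstLength_singleton (p : Plane) : mstLength {p} = 0 := by
  refine le_antisymm ?_ (mstLength_nonneg (Finset.singleton_nonempty p))
  have hs : Subsingleton ({p} : Finset Plane) :=
    ⟨fun a b => Subtype.ext ((Finset.mem_singleton.1 a.2).trans (Finset.mem_singleton.1 b.2).symm)⟩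
  have hG : (⊥ : SimpleGraph ({p} : Finset Plane)).Connected :=
    { preconnected := fun u v => by rw [Subsingleton.elim u v]
      nonempty := ⟨⟨p, Finset.mem_singleton_self p⟩⟩ }
  refine (mstLength_le_graphLength (Finset.singleton_nonempty p) hG).trans ?_
  refine (Finset.sum_eq_zero fun e _ => ?_).le
  induction e with
  | h a b => rw [Subsingleton.elim a b, edgeLength_mk, dist_self]

open Classical in
/-- Attaching every point of `R` to some point of `B`. -/
theorem mstLength_union_le {R B : Finset Plane} (hdisj : Disjoint R B) (b : Plane → Plane)
    (hb : ∀ r ∈ R, b r ∈ B) :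
    mstLength (R ∪ B) ≤ mstLength B + ∑ r ∈ R, dist r (b r) := by
  induction R using Finset.induction_on with
  | empty => simp
  | insert a s ha ih =>
    rw [Finset.disjoint_insert_left] at hdisj
    have h1 := ih hdisj.2 fun r hr => hb r (Finset.mem_insert_of_mem hr)
    have h2 : mstLength (insert a (s ∪ B)) ≤ mstLength (s ∪ B) + dist a (b a) :=
      mstLength_insert_le (by simp [ha, hdisj.1])
        (Finset.mem_union_right _ (hb a (Finset.mem_insert_self _ _)))
    rw [Finset.insert_union, Finset.sum_insert ha]
    linarith

/-- If the plane is projected to a curve with parameter `s`, each point `p` at distance at most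
`t p` from its projection, then walking along the curve with detours spans the set. -/
theorem mstLength_le_of_dist_le {S : Finset Plane} (hS : S.Nonempty) (s t : Plane → ℝ) {L : ℝ}
    (hs0 : ∀ p ∈ S, 0 ≤ s p) (hsL : ∀ p ∈ S, s p ≤ L) (ht : ∀ p ∈ S, 0 ≤ t p)
    (hst : ∀ p ∈ S, ∀ q ∈ S, s p ≤ s q → dist p q ≤ s q - s p + t p + t q) :
    mstLength S ≤ L + 2 * ∑ p ∈ S, t p := by
  classical
  have key : S.Nonempty → (∀ p ∈ S, 0 ≤ s p) → (∀ p ∈ S, 0 ≤ t p) →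
      (∀ p ∈ S, ∀ q ∈ S, s p ≤ s q → dist p q ≤ s q - s p + t p + t q) →
      -- Points are added in order of `s`; the detour from the last point `q` back to the curve is
      -- not yet paid, hence `- t q`.
      ∃ q ∈ S, (∀ p ∈ S, s p ≤ s q) ∧ mstLength S ≤ s q + 2 * ∑ p ∈ S, t p - t q := by
    clear hS hs0 hsL ht hst
    induction S using Finset.induction_on_max_value s with
    | empty => simp
    | insert a S ha hmax ih =>
      intro _ hs0 ht hst
      refine ⟨a, Finset.mem_insert_self _ _, by simpa using hmax, ?_⟩
      rw [Finset.sum_insert ha]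
      have hta := ht a (Finset.mem_insert_self _ _)
      have hsa := hs0 a (Finset.mem_insert_self _ _)
      rcases S.eq_empty_or_nonempty with rfl | hS
      · have := mstLength_singleton a
        simp only [insert_empty_eq, this, Finset.sum_empty]
        linarith
      · obtain ⟨q, hq, -, hle⟩ := ih hS (fun p hp => hs0 p (Finset.mem_insert_of_mem hp))
          (fun p hp => ht p (Finset.mem_insert_of_mem hp))
          (fun p hp q hq => hst p (Finset.mem_insert_of_mem hp) q (Finset.mem_insert_of_mem hq))
        have h1 := mstLength_insert_le ha hq
        have h2 := hst q (Finset.mem_insert_of_mem hq) a (Finset.mem_insert_self _ _) (hmax q hq)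
        rw [dist_comm] at h2
        linarith
  obtain ⟨q, hq, -, hle⟩ := key hS hs0 ht hst
  have := hsL q hq
  have := ht q hq
  linarith

/-! ### Packing and greedy selection -/

/-- Disc packing: few points of an `m`-separated set lie within distance `l` of a given point. -/
theorem card_filter_dist_lt_le {S : Finset Plane} {m l : ℝ} (hm : 0 < m) (hl : 0 ≤ l)
    (hS : ∀ p ∈ S, ∀ q ∈ S, p ≠ q → m ≤ dist p q) (p : Plane) :
    ((S.filter fun q => dist q p < l).card : ℝ) ≤ (2 * l / m + 1) ^ 2 := by
  set A := S.filter fun q => dist q p < l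
  have hvol : ∀ (x : Plane) (r : ℝ), 0 ≤ r →
      MeasureTheory.volume.real (Metric.ball x r) = Real.pi * r ^ 2 := by
    intro x r hr
    rw [MeasureTheory.measureReal_def, EuclideanSpace.volume_ball_fin_two]
    simp [ENNReal.toReal_ofReal hr, Real.pi_pos.le, mul_comm]
  have hdisj : (A : Set Plane).PairwiseDisjoint fun q => Metric.ball q (m / 2) := by
    intro x hx y hy hxy
    refine Metric.ball_disjoint_ball ?_
    have := hS x (Finset.mem_filter.1 hx).1 y (Finset.mem_filter.1 hy).1 hxy
    linarith
  have hU := MeasureTheory.measureReal_biUnion_finset (μ := MeasureTheory.volume) hdisj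
    (fun q _ => Metric.isOpen_ball.measurableSet) (fun q _ => MeasureTheory.measure_ball_lt_top.ne)
  have hle : MeasureTheory.volume.real (⋃ q ∈ A, Metric.ball q (m / 2)) ≤
      MeasureTheory.volume.real (Metric.ball p (l + m / 2)) := by
    refine MeasureTheory.measureReal_mono ?_ MeasureTheory.measure_ball_lt_top.ne
    refine Set.iUnion₂_subset fun q hq => Metric.ball_subset_ball' ?_
    have := (Finset.mem_filter.1 hq).2
    linarith
  rw [hU, Finset.sum_congr rfl fun q _ => hvol q (m / 2) (by positivity), Finset.sum_const,
    nsmul_eq_mul, hvol _ _ (by positivity)] at hle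
  have h2 : (A.card : ℝ) * m ^ 2 ≤ (2 * l + m) ^ 2 := by
    have : Real.pi * ((A.card : ℝ) * m ^ 2) ≤ Real.pi * (2 * l + m) ^ 2 := by
      linear_combination 4 * hle
    exact le_of_mul_le_mul_left this Real.pi_pos
  have h3 : 2 * l / m + 1 = (2 * l + m) / m := by field_simp
  rw [h3, div_pow, le_div_iff₀ (by positivity)]
  exact h2

/-- Greedy selection by decreasing weight yields an `l`-separated subset of large weight. -/
theorem exists_separated_subset_weight {l M : ℝ} (hl : 0 < l) (g : Plane → ℝ) (Q : Finset Plane)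
    (hg : ∀ p ∈ Q, 0 ≤ g p)
    (hM : ∀ p ∈ Q, ((Q.filter fun q => dist q p < l).card : ℝ) ≤ M) :
    ∃ R ⊆ Q, (∀ p ∈ R, ∀ q ∈ R, p ≠ q → l ≤ dist p q) ∧
      ∑ p ∈ Q, g p ≤ M * ∑ p ∈ R, g p := by
  classical
  induction Q using Finset.strongInduction with
  | H Q ih =>
    rcases Q.eq_empty_or_nonempty with rfl | hQ
    · exact ⟨∅, by simp⟩
    obtain ⟨p, hp, hmax⟩ := Finset.exists_max_image Q g hQ
    have hsub : Q.filter (fun q => ¬ dist q p < l) ⊆ Q := Finset.filter_subset _ _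
    have hss : Q.filter (fun q => ¬ dist q p < l) ⊂ Q :=
      (Finset.ssubset_iff_of_subset hsub).2 ⟨p, hp, by simp [hl]⟩
    obtain ⟨R, hR, hsep, hsum⟩ := ih _ hss (fun q hq => hg q (hsub hq)) fun q hq =>
      (Nat.cast_le.2 (Finset.card_le_card (Finset.filter_subset_filter _ hsub))).trans
        (hM q (hsub hq))
    have hfar : ∀ q ∈ R, l ≤ dist q p := fun q hq => not_lt.1 (Finset.mem_filter.1 (hR hq)).2
    have hpR : p ∉ R := fun h => by
      have := hfar p h
      rw [dist_self] at this
      linarith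
    refine ⟨insert p R, Finset.insert_subset hp (hR.trans hsub), ?_, ?_⟩
    · intro a ha b hb hab
      rcases Finset.mem_insert.1 ha with rfl | ha' <;> rcases Finset.mem_insert.1 hb with rfl | hb'
      · exact absurd rfl hab
      · rw [dist_comm]; exact hfar b hb'
      · exact hfar a ha'
      · exact hsep a ha' b hb' hab
    · rw [Finset.sum_insert hpR, mul_add, ← Finset.sum_filter_add_sum_filter_not Q
        (fun q => dist q p < l) g]
      refine add_le_add ?_ hsum
      -- The points discarded with `p` number at most `M`, and none outweighs `p`.
      refine (Finset.sum_le_card_nsmul _ _ (g p)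
        fun q hq => hmax q (Finset.mem_filter.1 hq).1).trans ?_
      rw [nsmul_eq_mul]
      exact mul_le_mul_of_nonneg_right (hM p hp) (hg p hp)

/-! ### Few's strip bound -/

theorem plane_dist_le (p q : Plane) : dist p q ≤ |p 0 - q 0| + |p 1 - q 1| := by
  rw [EuclideanSpace.dist_eq, Fin.sum_univ_two, Real.dist_eq, Real.dist_eq]
  refine Real.sqrt_le_iff.2 ⟨by positivity, ?_⟩
  nlinarith [abs_nonneg (p 0 - q 0), abs_nonneg (p 1 - q 1)]

theorem abs_sub_apply_le_dist (p q : Plane) (i : Fin 2) : |p i - q i| ≤ dist p q := by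
  rw [← Real.dist_eq]
  exact PiLp.dist_apply_le p q i

/-- A boustrophedon walk along vertical strips of width `h`, cut with offset `θ`. -/
theorem mstLength_le_of_strips {S : Finset Plane} (hS : S.Nonempty) {x₀ y₀ D h θ : ℝ}
    (hh : 0 < h) (hθ0 : 0 ≤ θ) (hθ1 : θ ≤ 1 / 2)
    (hx : ∀ p ∈ S, 0 ≤ p 0 - x₀ ∧ p 0 - x₀ ≤ D) (hy : ∀ p ∈ S, 0 ≤ p 1 - y₀ ∧ p 1 - y₀ ≤ D) :
    mstLength S ≤ (D / h + 1 / 2) * (D + h) + D +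
      2 * ∑ p ∈ S, |(p 0 - x₀) - (⌊(p 0 - x₀) / h + θ⌋ + 1 / 2 - θ) * h| := by
  have hD : 0 ≤ D := by
    obtain ⟨p, hp⟩ := hS
    linarith [(hx p hp).1, (hx p hp).2]
  let j : Plane → ℤ := fun p => ⌊(p 0 - x₀) / h + θ⌋
  -- Arc length along the walk: each strip costs `D` vertically and `h` to change strip, with
  -- direction alternating by parity.
  let s : Plane → ℝ := fun p =>
    j p * (D + h) + if Even (j p) then p 1 - y₀ else D - (p 1 - y₀)
  let t : Plane → ℝ := fun p => |(p 0 - x₀) - (j p + 1 / 2 - θ) * h|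
  have hj0 : ∀ p ∈ S, 0 ≤ j p := fun p hp => Int.floor_nonneg.2
    (add_nonneg (div_nonneg (hx p hp).1 hh.le) hθ0)
  have hj1 : ∀ p ∈ S, (j p : ℝ) ≤ D / h + 1 / 2 := fun p hp =>
    (Int.floor_le _).trans (add_le_add (div_le_div_of_nonneg_right (hx p hp).2 hh.le) hθ1)
  have hlt : ∀ p ∈ S, ∀ q ∈ S, j p < j q →
      (j q - j p) * h + |p 1 - q 1| ≤ s q - s p := by
    intro p hp q hq hpq
    obtain ⟨hp1, hp2⟩ := hy p hp
    obtain ⟨hq1, hq2⟩ := hy q hq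
    rcases (Int.add_one_le_iff.2 hpq).eq_or_lt with h1 | h1
    · have hcast : (j q : ℝ) = j p + 1 := by rw [← h1]; push_cast; ring
      have hpar : Even (j q) ↔ ¬ Even (j p) := by rw [← h1, Int.even_add_one]
      simp only [s, hpar, hcast]
      by_cases he : Even (j p)
      · simp only [he, not_true_eq_false, if_true, if_false]
        have : |p 1 - q 1| ≤ 2 * D - (p 1 - y₀) - (q 1 - y₀) :=
          abs_le.2 ⟨by linarith, by linarith⟩
        linarith
      · simp only [he, not_false_eq_true, if_true, if_false]
        have : |p 1 - q 1| ≤ (p 1 - y₀) + (q 1 - y₀) :=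
          abs_le.2 ⟨by linarith, by linarith⟩
        linarith
    -- A whole strip lies in between, and its length `D` covers any vertical difference.
    · have hcast : (j p : ℝ) + 2 ≤ j q := by
        have : j p + 2 ≤ j q := by omega
        exact_mod_cast this
      have habs : |p 1 - q 1| ≤ D := abs_le.2 ⟨by linarith, by linarith⟩
      have hsq : (j q : ℝ) * (D + h) ≤ s q := by
        simp only [s]
        split_ifs <;> linarith
      have hsp : s p ≤ j p * (D + h) + D := by
        simp only [s]
        split_ifs <;> linarith
      nlinarith [mul_nonneg (sub_nonneg.2 hcast) hD]
  have hdist : ∀ p q : Plane, dist p q ≤ |(j p : ℝ) - j q| * h + |p 1 - q 1| + t p + t q := by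
    intro p q
    refine (plane_dist_le p q).trans ?_
    have h1 : p 0 - q 0 = ((p 0 - x₀) - (j p + 1 / 2 - θ) * h) + ((j p : ℝ) - j q) * h
        - ((q 0 - x₀) - (j q + 1 / 2 - θ) * h) := by ring
    have h2 : |p 0 - q 0| ≤ t p + |(j p : ℝ) - j q| * h + t q := by
      rw [h1]
      refine (abs_sub _ _).trans (add_le_add ((abs_add_le _ _).trans ?_) le_rfl)
      rw [abs_mul, abs_of_pos hh]
    linarith
  refine mstLength_le_of_dist_le hS s t ?_ ?_ (fun p _ => abs_nonneg _) ?_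
  · intro p hp
    obtain ⟨h1, h2⟩ := hy p hp
    have h3 : (0 : ℝ) ≤ j p := by exact_mod_cast hj0 p hp
    have h4 : 0 ≤ (j p : ℝ) * (D + h) := by positivity
    simp only [s]
    split_ifs <;> linarith
  · intro p hp
    obtain ⟨h1, h2⟩ := hy p hp
    have h4 : (j p : ℝ) * (D + h) ≤ (D / h + 1 / 2) * (D + h) :=
      mul_le_mul_of_nonneg_right (hj1 p hp) (by positivity)
    simp only [s]
    split_ifs <;> linarith
  · intro p hp q hq hpq
    refine (hdist p q).trans ?_
    rcases lt_trichotomy (j p) (j q) with hlt' | heq | hgt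
    · have h1 := hlt p hp q hq hlt'
      have h2 : (j p : ℝ) < j q := by exact_mod_cast hlt'
      rw [abs_sub_comm, abs_of_pos (sub_pos.2 h2)]
      linarith
    · have h1 : |p 1 - q 1| = s q - s p := by
        simp only [s, heq] at hpq ⊢
        split_ifs at hpq ⊢
        · rw [abs_sub_comm, abs_of_nonneg (by linarith)]; ring
        · rw [abs_of_nonneg (by linarith)]; ring
      rw [heq, sub_self, abs_zero]
      linarith
    · have h1 := hlt q hq p hp hgt
      have h2 : (j q : ℝ) < j p := by exact_mod_cast hgt
      have h3 : 0 < ((j p : ℝ) - j q) * h := mul_pos (sub_pos.2 h2) hh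
      linarith [abs_nonneg (q 1 - p 1)]

/-- The centre lines of the two strip families alternate at spacing 1/2, and `u` lies between the
two consecutive ones chosen. -/
theorem abs_sub_floor_add_abs_sub_round (u : ℝ) :
    |u - (⌊u + 0⌋ + 1 / 2 - 0)| + |u - (⌊u + 1 / 2⌋ + 1 / 2 - 1 / 2)| = 1 / 2 := by
  rw [add_zero]
  have h0 := Int.floor_le u
  have h1 := Int.lt_floor_add_one u
  rcases lt_or_ge (u - ⌊u⌋) (1 / 2) with h | h
  · have : ⌊u + 1 / 2⌋ = ⌊u⌋ := Int.floor_eq_iff.2 ⟨by linarith, by linarith⟩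
    rw [this, abs_of_nonpos (by linarith), abs_of_nonneg (by linarith)]
    ring
  · have : ⌊u + 1 / 2⌋ = ⌊u⌋ + 1 :=
      Int.floor_eq_iff.2 ⟨by push_cast; linarith, by push_cast; linarith⟩
    rw [this, abs_of_nonneg (by linarith), abs_of_nonpos (by push_cast; linarith)]
    push_cast
    ring

/-- Few's bound: averaging two families of strips. -/
theorem mstLength_le_of_diam_le {S : Finset Plane} (hS : S.Nonempty) {D h : ℝ} (hh : 0 < h)
    (hD : ∀ p ∈ S, ∀ q ∈ S, dist p q ≤ D) :
    mstLength S ≤ (D / h + 1 / 2) * (D + h) + D + S.card * h / 2 := by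
  obtain ⟨a, ha, hamin⟩ := Finset.exists_min_image S (fun p => p 0) hS
  obtain ⟨b, hb, hbmin⟩ := Finset.exists_min_image S (fun p => p 1) hS
  have hx : ∀ p ∈ S, 0 ≤ p 0 - a 0 ∧ p 0 - a 0 ≤ D := fun p hp =>
    ⟨sub_nonneg.2 (hamin p hp), (le_abs_self _).trans
      ((abs_sub_apply_le_dist p a 0).trans (hD p hp a ha))⟩
  have hy : ∀ p ∈ S, 0 ≤ p 1 - b 1 ∧ p 1 - b 1 ≤ D := fun p hp =>
    ⟨sub_nonneg.2 (hbmin p hp), (le_abs_self _).trans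
      ((abs_sub_apply_le_dist p b 1).trans (hD p hp b hb))⟩
  have h1 := mstLength_le_of_strips hS hh le_rfl (by norm_num) hx hy
  have h2 := mstLength_le_of_strips hS hh (by norm_num) le_rfl hx hy
  have hsum : ∑ p ∈ S, |(p 0 - a 0) - (⌊(p 0 - a 0) / h + 0⌋ + 1 / 2 - 0) * h| +
      ∑ p ∈ S, |(p 0 - a 0) - (⌊(p 0 - a 0) / h + 1 / 2⌋ + 1 / 2 - 1 / 2) * h| =
      S.card * (h / 2) := by
    rw [← Finset.sum_add_distrib, ← nsmul_eq_mul, ← Finset.sum_const]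
    refine Finset.sum_congr rfl fun p _ => ?_
    have hscale : ∀ c : ℝ, |(p 0 - a 0) - c * h| = |(p 0 - a 0) / h - c| * h := by
      intro c
      rw [← abs_of_pos hh, ← abs_mul, abs_of_pos hh, sub_mul, div_mul_cancel₀ _ hh.ne']
    rw [hscale, hscale, ← add_mul, abs_sub_floor_add_abs_sub_round]
    ring
  linarith

/-! ### The bipartition and the final estimate -/

/-- A bipartition of an `m`-separated set of diameter at most `D` whose trees are longer than the
minimum spanning tree, obtained by colouring a sparse set of points with close neighbours. -/
theorem exists_bipartition_mstLength {P : Finset Plane} (hP : 2 ≤ P.card) {m D l : ℝ}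
    (hm : 0 < m) (hl : 0 < l) (hsep : ∀ p ∈ P, ∀ q ∈ P, p ≠ q → m ≤ dist p q)
    (hD : ∀ p ∈ P, ∀ q ∈ P, dist p q ≤ D) (hpos : mstLength P + D < P.card * l) :
    ∃ R B : Finset Plane, R.Nonempty ∧ B.Nonempty ∧ Disjoint R B ∧
      (R : Set Plane) ∪ (B : Set Plane) = (P : Set Plane) ∧
      mstLength P + (P.card * l - mstLength P - D) / (2 * l / m + 1) ^ 2 - l ≤
        mstLength R + mstLength B := by
  classical
  have hnb : ∀ p ∈ P, ∃ q ∈ P, q ≠ p ∧ ∀ q' ∈ P, p ≠ q' → dist p q ≤ dist p q' := by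
    intro p hp
    have hne : (P.erase p).Nonempty := by
      rw [← Finset.card_pos, Finset.card_erase_of_mem hp]
      omega
    obtain ⟨q, hq, hmin⟩ := Finset.exists_min_image (P.erase p) (fun q => dist p q) hne
    exact ⟨q, Finset.mem_of_mem_erase hq, Finset.ne_of_mem_erase hq,
      fun q' hq' hne => hmin q' (Finset.mem_erase.2 ⟨hne.symm, hq'⟩)⟩
  choose! b hbP hbne hbmin using hnb
  set M : ℝ := (2 * l / m + 1) ^ 2
  have hMpos : 0 < M := by positivity
  let Q := P.filter fun p => dist p (b p) < l
  have hQP : Q ⊆ P := Finset.filter_subset _ _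
  obtain ⟨R, hRQ, hRsep, hRsum⟩ := exists_separated_subset_weight (M := M) hl
    (fun p => l - dist p (b p)) Q
    (fun p hp => sub_nonneg.2 (Finset.mem_filter.1 hp).2.le)
    (fun p _ => card_filter_dist_lt_le hm hl.le
      (fun p hp q hq => hsep p (hQP hp) q (hQP hq)) p)
  have hRP : R ⊆ P := hRQ.trans hQP
  have hnn : ∑ p ∈ P, dist p (b p) ≤ mstLength P + D := by
    obtain ⟨r, hr⟩ : P.Nonempty := Finset.card_pos.1 (by omega)
    have h1 := sum_erase_le_mstLength hr (fun p => dist p (b p)) hbmin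
    have h2 := Finset.sum_erase_add P (fun p => dist p (b p)) hr
    have h3 := hD r hr (b r) (hbP r hr)
    linarith
  have hQsum : P.card * l - mstLength P - D ≤ ∑ p ∈ Q, (l - dist p (b p)) := by
    have h1 := Finset.sum_filter_add_sum_filter_not P (fun p => dist p (b p) < l)
      (fun p => l - dist p (b p))
    have h2 : ∑ p ∈ P.filter (fun p => ¬ dist p (b p) < l), (l - dist p (b p)) ≤ 0 :=
      Finset.sum_nonpos fun p hp => sub_nonpos.2 (not_lt.1 (Finset.mem_filter.1 hp).2)
    have h3 : ∑ p ∈ P, (l - dist p (b p)) = P.card * l - ∑ p ∈ P, dist p (b p) := by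
      rw [Finset.sum_sub_distrib, Finset.sum_const, nsmul_eq_mul]
    linarith
  have hRne : R.Nonempty := by
    rw [Finset.nonempty_iff_ne_empty]
    rintro rfl
    rw [Finset.sum_empty, mul_zero] at hRsum
    linarith
  -- The neighbour `b r` is closer than `l`, so separation excludes it from `R`.
  have hbB : ∀ r ∈ R, b r ∈ P \ R := by
    intro r hr
    refine Finset.mem_sdiff.2 ⟨hbP r (hRP hr), fun hb => ?_⟩
    have h1 := hRsep r hr (b r) hb (hbne r (hRP hr)).symm
    have h2 := (Finset.mem_filter.1 (hRQ hr)).2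
    linarith
  refine ⟨R, P \ R, hRne, ?_, Finset.disjoint_sdiff, ?_, ?_⟩
  · obtain ⟨r, hr⟩ := hRne
    exact ⟨b r, hbB r hr⟩
  · rw [← Finset.coe_union, Finset.union_sdiff_of_subset hRP]
  · have h1 := mstLength_union_le Finset.disjoint_sdiff b hbB
    rw [Finset.union_sdiff_of_subset hRP] at h1
    have h2 := mul_card_sub_one_le_mstLength hRne hRsep
    have h3 : ∑ p ∈ R, (l - dist p (b p)) = R.card * l - ∑ p ∈ R, dist p (b p) := by
      rw [Finset.sum_sub_distrib, Finset.sum_const, nsmul_eq_mul]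
    have h4 : (P.card * l - mstLength P - D) / M ≤ ∑ p ∈ R, (l - dist p (b p)) := by
      rw [div_le_iff₀' hMpos]
      exact hQsum.trans hRsum
    linarith

/-- The fourth power of the constant is 12/π² > 1. -/
theorem one_le_of_spread_constant_le {α : ℝ}
    (hα : (2 : ℝ) ^ (1 / 2 : ℝ) * (3 : ℝ) ^ (1 / 4 : ℝ) * Real.pi ^ (-1 / 2 : ℝ) ≤ α) :
    1 ≤ α := by
  refine le_trans ?_ hα
  set x := (2 : ℝ) ^ (1 / 2 : ℝ) * (3 : ℝ) ^ (1 / 4 : ℝ) * Real.pi ^ (-1 / 2 : ℝ) with hx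
  have hx0 : 0 ≤ x := by positivity
  have h4 : x ^ 4 = 12 / Real.pi ^ 2 := by
    rw [hx, mul_pow, mul_pow, ← Real.rpow_mul_natCast (by norm_num),
      ← Real.rpow_mul_natCast (by norm_num), ← Real.rpow_mul_natCast Real.pi_pos.le]
    have e1 : (1 / 2 : ℝ) * (4 : ℕ) = (2 : ℕ) := by norm_num
    have e2 : (1 / 4 : ℝ) * (4 : ℕ) = (1 : ℕ) := by norm_num
    have e3 : (-1 / 2 : ℝ) * (4 : ℕ) = -(2 : ℕ) := by norm_num
    rw [e1, e2, e3, Real.rpow_neg Real.pi_pos.le, Real.rpow_natCast, Real.rpow_natCast,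
      Real.rpow_natCast]
    norm_num
    ring
  by_contra! hlt
  have h5 : x ^ 4 < 1 := pow_lt_one₀ hx0 hlt (by norm_num)
  rw [h4, div_lt_one (by positivity)] at h5
  nlinarith [Real.pi_lt_d2, Real.pi_pos]

/-- The quantitative bound, with an explicit threshold on the number of points. -/
theorem one_add_le_maxMSTRatio {α : ℝ} (hα : 1 ≤ α) {P : Finset Plane}
    (hn : 1000000 * α ^ 2 ≤ P.card)
    (hspread : spread P ≤ α * (P.card : ℝ) ^ (1 / 2 : ℝ)) :
    1 + 1 / (11 * (2 * α + 1) ^ 2) ≤ maxMSTRatio P := by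
  have hcard : 2 ≤ P.card := by
    have : (2 : ℝ) ≤ P.card := by nlinarith
    exact_mod_cast this
  have hne : P.Nonempty := Finset.card_pos.1 (by omega)
  set n : ℝ := (P.card : ℝ)
  set m : ℝ := Set.infsep (P : Set Plane)
  set D : ℝ := Metric.diam (P : Set Plane)
  set w : ℝ := mstLength P
  have hm : 0 < m := (Finset.infsep_pos_iff_nontrivial P).2
    (Finset.one_lt_card_iff_nontrivial.1 (by omega))
  have hsep : ∀ p ∈ P, ∀ q ∈ P, p ≠ q → m ≤ dist p q := fun p hp q hq =>
    Set.infsep_le_dist_of_mem hp hq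
  have hD : ∀ p ∈ P, ∀ q ∈ P, dist p q ≤ D := fun p hp q hq =>
    Metric.dist_le_diam_of_mem P.finite_toSet.isBounded hp hq
  obtain ⟨K, hK⟩ : ∃ K : ℝ, K = Real.sqrt n := ⟨_, rfl⟩
  have hKn : K ^ 2 = n := by rw [hK]; exact Real.sq_sqrt (Nat.cast_nonneg _)
  have hKα : 1000 * α ≤ K := by
    rw [hK]
    exact Real.le_sqrt_of_sq_le (by linarith [mul_pow 1000 α 2])
  have hK0 : 0 < K := by linarith
  have hDm : D ≤ α * K * m := by
    rw [← Real.sqrt_eq_rpow, ← hK] at hspread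
    exact (div_le_iff₀ hm).1 hspread
  have hD0 : 0 < D := by
    obtain ⟨p, hp, q, hq, hpq⟩ := Finset.one_lt_card.1 hcard
    exact hm.trans_le ((hsep p hp q hq hpq).trans (hD p hp q hq))
  have hwD : w ≤ 3 / 2 * (D * K) := by
    -- The leading terms D²/h + nh/2 are least at h = √2·D/√n; 7/5 approximates √2, and 3/2 absorbs
    -- the terms of order D.
    have h1 := mstLength_le_of_diam_le hne (D := D) (h := 7 / 5 * D / K) (by positivity) hD
    have h2 : D / (7 / 5 * D / K) = 5 / 7 * K := by field_simp
    have h3 : n * (7 / 5 * D / K) / 2 = 7 / 10 * (D * K) := by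
      rw [← hKn]; field_simp; ring
    have h4 : 7 / 5 * D / K ≤ D := by
      rw [div_le_iff₀ hK0]; nlinarith
    have h5 : K * (7 / 5 * D / K) = 7 / 5 * D := by field_simp
    rw [h2, h3] at h1
    nlinarith
  have hwm : m * (n - 1) ≤ w := mul_card_sub_one_le_mstLength hne hsep
  -- `D` is at most αKm, while `w` is at least m(K² - 1) and K ≥ 1000α.
  have hDw : 20 * D ≤ w := by
    have h1 : 20 * (α * K) ≤ n - 1 := by rw [← hKn]; nlinarith
    have h2 := mul_le_mul_of_nonneg_left h1 hm.le
    linarith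
  have hw0 : 0 < w := by linarith
  have hn0 : 0 < n := by rw [← hKn]; positivity
  have hl : n * (2 * w / n) = 2 * w := by field_simp
  obtain ⟨R, B, hR, hB, hdisj, hU, hle⟩ := exists_bipartition_mstLength hcard (l := 2 * w / n) hm
    (by positivity) hsep hD (by change w + D < n * (2 * w / n); linarith)
  refine le_trans ?_ ((maxMSTRatio_isGreatest hcard).2 ⟨R, B, hR, hB, hdisj, hU, rfl⟩)
  change w + (n * (2 * w / n) - w - D) / _ - 2 * w / n ≤ _ at hle
  rw [hl] at hle
  rw [le_div_iff₀ hw0]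
  refine le_trans ?_ hle
  have hlm : 2 * (2 * w / n) / m + 1 ≤ 6 * α + 1 := by
    have h1 : w ≤ 3 / 2 * (α * m * n) := by
      have := mul_le_mul_of_nonneg_right hDm hK0.le
      rw [← hKn]
      linarith
    have h2 : 2 * (2 * w / n) / m = 4 * w / (m * n) := by field_simp; ring
    rw [h2, add_le_add_iff_right, div_le_iff₀ (by positivity)]
    linarith
  have hM : (19 / 20 * w) / (6 * α + 1) ^ 2 ≤
      (2 * w - w - D) / (2 * (2 * w / n) / m + 1) ^ 2 := by
    refine div_le_div₀ (by linarith) (by linarith) (by positivity) ?_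
    exact pow_le_pow_left₀ (by positivity) hlm 2
  refine le_trans ?_ (sub_le_sub_right (add_le_add_right hM w) _)
  -- The term `2 / n` pays for the lost `l`. As α grows the comparison is 36/0.95 < 44, which leaves
  -- room for the 2% spent on it.
  have hfinal : 1 / (11 * (2 * α + 1) ^ 2) + 2 / n ≤ 19 / 20 / (6 * α + 1) ^ 2 := by
    have h1 : 2 / n ≤ 1 / 50 / (11 * (2 * α + 1) ^ 2) := by
      rw [div_le_div_iff₀ hn0 (by positivity)]
      nlinarith
    have h2 : 51 / 50 / (11 * (2 * α + 1) ^ 2) ≤ 19 / 20 / (6 * α + 1) ^ 2 := by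
      rw [div_le_div_iff₀ (by positivity) (by positivity)]
      nlinarith
    have h3 : 1 / (11 * (2 * α + 1) ^ 2) + 1 / 50 / (11 * (2 * α + 1) ^ 2) =
        51 / 50 / (11 * (2 * α + 1) ^ 2) := by rw [← add_div]; norm_num
    linarith
  have h := mul_le_mul_of_nonneg_right hfinal hw0.le
  have e1 : 19 / 20 * w / (6 * α + 1) ^ 2 = 19 / 20 / (6 * α + 1) ^ 2 * w := by ring
  have e2 : 2 * w / n = 2 / n * w := by ring
  rw [e1, e2]
  linarith

theorem theorem4 :
    (∃ c : ℝ, 0 < c ∧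
      ∀ α : ℝ, (2 : ℝ) ^ (1 / 2 : ℝ) * (3 : ℝ) ^ (1 / 4 : ℝ) * Real.pi ^ (-1 / 2 : ℝ) ≤ α →
        ∃ N : ℕ, ∀ P : Finset Plane, N ≤ P.card →
          spread P ≤ α * (P.card : ℝ) ^ (1 / 2 : ℝ) →
            1 + c * α ^ (-2 : ℝ) ≤ maxMSTRatio P) ∧
    (∀ α : ℝ, (2 : ℝ) ^ (1 / 2 : ℝ) * (3 : ℝ) ^ (1 / 4 : ℝ) * Real.pi ^ (-1 / 2 : ℝ) ≤ α →
      ∃ N : ℕ, ∀ P : Finset Plane, N ≤ P.card →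
        spread P ≤ α * (P.card : ℝ) ^ (1 / 2 : ℝ) →
          1 + 1 / (11 * (2 * α + 1) ^ 2) ≤ maxMSTRatio P) := by
  have main : ∀ α : ℝ,
      (2 : ℝ) ^ (1 / 2 : ℝ) * (3 : ℝ) ^ (1 / 4 : ℝ) * Real.pi ^ (-1 / 2 : ℝ) ≤ α →
      ∃ N : ℕ, ∀ P : Finset Plane, N ≤ P.card →
        spread P ≤ α * (P.card : ℝ) ^ (1 / 2 : ℝ) →
          1 + 1 / (11 * (2 * α + 1) ^ 2) ≤ maxMSTRatio P := fun α hα =>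
    ⟨⌈1000000 * α ^ 2⌉₊, fun P hP hspread =>
      one_add_le_maxMSTRatio (one_le_of_spread_constant_le hα) (Nat.ceil_le.1 hP) hspread⟩
  -- For α ≥ 1, 11(2α + 1)² ≤ 11(3α)² = 99α².
  refine ⟨⟨1 / 99, by norm_num, fun α hα => ?_⟩, main⟩
  have hα1 := one_le_of_spread_constant_le hα
  obtain ⟨N, hN⟩ := main α hα
  refine ⟨N, fun P hP hspread => le_trans ?_ (hN P hP hspread)⟩
  have e : α ^ (-2 : ℝ) = 1 / α ^ 2 := by
    rw [Real.rpow_neg (by linarith), Real.rpow_ofNat, one_div]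
  rw [e, add_le_add_iff_left, div_mul_div_comm, one_mul]
  refine one_div_le_one_div_of_le (by positivity) ?_
  nlinarith
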